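/- Let $X\subset\mathbb{R}^n$ be a finite set (for instance any set of binary vectors $X\subseteq\{0,1\}^n$), and let $m\ge 1$. For scenarios $c_j=(\tilde c_j,\bar c_j)\in\mathbb{R}\times\mathbb{R}^n$, $j=1,\dots,m$, put $f(x)=\max_{1\le j\le m}(\bar c_j^\top x+\tilde c_j)$ for $x\in\mathbb{R}^n$, and consider the minimization of $f$ over $\operatorname{conv}(X)$ by the following algorithm SD-DROP. Start with $V^1=\{\hat x^0\}$ for an arbitrary $\hat x^0\in X$. In iteration $k=1,2,\dots$: 1. A first oracle returns any $\alpha^k\in\mathbb{R}^{V^k}$ with $\alpha^k\ge 0$ and $\sum_{v\in V^k}\alpha^k_v=1$, the point $x^k=\sum_{v\in V^k}\alpha^k_v v$, and a vector $c^k\in\partial f(x^k)\cap\bigl(-\mathcal{N}_{\operatorname{conv}(V^k)}(x^k)\bigr)$, where $\partial f$ is the subdifferential and $\mathcal{N}$ denotes the normal cone (so $x^k$ minimizes $f$ over $\operatorname{conv}(V^k)$). 2. A second oracle returns any minimizer $\hat x^k$ of $(c^k)^\top x$ over $x\in X$. 3. If $(c^k)^\top\hat x^k\ge (c^k)^\top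 x^k$, stop. Otherwise set $V^{k+1}=\{v\in V^k\mid \alpha^k_v>0\}\cup\{\hat x^k\}$ and continue. **Theorem.** Let $c_1,\dots,c_m\in\mathbb{R}^{n+1}$ be arbitrary, and replace $c_j$ by $c_j+\delta_j$ for all $j$ (constant terms included), where $\delta=(\delta_1,\dots,\delta_m)$ is any random vector in $\mathbb{R}^{m(n+1)}$ with continuous distribution, i.e. whose law is absolutely continuous with respect to Lebesgue measure (its support is then automatically full-dimensional). Then, with probability one, SD-DROP applied to the perturbed scenarios terminates after finitely many iterations, for every choice of the starting point and of the oracle answers. -/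

import Mathlib

open MeasureTheory

/-- The objective `f(x) = max_j (c̄_jᵀ x + c̃_j)` for the finite family of scenarios
`c_j = (c̃_j, c̄_j) ∈ ℝ × ℝⁿ`, the first component being the uncertain constant. -/
noncomputable def worstCase {n m : ℕ} [NeZero m] (c : Fin m → ℝ × (Fin n → ℝ))
    (x : Fin n → ℝ) : ℝ :=
  Finset.univ.sup' Finset.univ_nonempty (fun j : Fin m => (c j).2 ⬝ᵥ x + (c j).1)

/-- The (convex) subdifferential `∂f(x)`. -/
def subdiff {n : ℕ} (f : (Fin n → ℝ) → ℝ) (x : Fin n → ℝ) : Set (Fin n → ℝ) :=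
  {g | ∀ y, f x + g ⬝ᵥ (y - x) ≤ f y}

/-- The normal cone `N_C(x)` of a convex set `C` at `x` (empty if `x ∉ C`). -/
def normalCone {n : ℕ} (C : Set (Fin n → ℝ)) (x : Fin n → ℝ) : Set (Fin n → ℝ) :=
  {g | x ∈ C ∧ ∀ y ∈ C, g ⬝ᵥ (y - x) ≤ 0}

/-- `(α, x, c)` is an admissible answer of the oracle SIM-O to the finite set `V`: `α` is a vector of
convex coefficients on `V`, `x = ∑ α_v v`, and `c ∈ ∂f(x) ∩ (-N_{conv V}(x))`.
Only the values of `α` on `V` matter. -/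
structure IsSimOutput {n : ℕ} (f : (Fin n → ℝ) → ℝ) (V : Finset (Fin n → ℝ))
    (α : (Fin n → ℝ) → ℝ) (x c : Fin n → ℝ) : Prop where
  nonneg : ∀ v ∈ V, 0 ≤ α v
  sum_eq_one : ∑ v ∈ V, α v = 1
  point_eq : x = ∑ v ∈ V, α v • v
  mem_subdiff : c ∈ subdiff f x
  neg_mem_normalCone : -c ∈ normalCone (convexHull ℝ (V : Set (Fin n → ℝ))) x

/-- `y` is an admissible answer of the oracle LIN-O to the objective `c`:
a minimizer of `cᵀ z` over `z ∈ X`. -/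
def IsLinOutput {n : ℕ} (X : Set (Fin n → ℝ)) (c y : Fin n → ℝ) : Prop :=
  y ∈ X ∧ ∀ z ∈ X, c ⬝ᵥ y ≤ c ⬝ᵥ z

open Classical in
/-- The dropping rule: `{v ∈ V | α_v > 0} ∪ {y}`. -/
noncomputable def dropUpdate {n : ℕ} (V : Finset (Fin n → ℝ)) (α : (Fin n → ℝ) → ℝ)
    (y : Fin n → ℝ) : Finset (Fin n → ℝ) :=
  V.filter (fun v => 0 < α v) ∪ {y}

/-- The data `(V^k, α^k, x^k, c^k, x̂^k)` of all iterations of the algorithm, the index `k = 0` being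
the first iteration. -/
structure SDTrace (n : ℕ) where
  V : ℕ → Finset (Fin n → ℝ)
  α : ℕ → (Fin n → ℝ) → ℝ
  x : ℕ → (Fin n → ℝ)
  c : ℕ → (Fin n → ℝ)
  xhat : ℕ → (Fin n → ℝ)

namespace SDTrace

/-- The stopping test of iteration `k`. -/
def StopsAt {n : ℕ} (t : SDTrace n) (k : ℕ) : Prop :=
  t.c k ⬝ᵥ t.x k ≤ t.c k ⬝ᵥ t.xhat k

/-- Iteration `k` is executed: no earlier iteration has stopped. -/
def Reaches {n : ℕ} (t : SDTrace n) (k : ℕ) : Prop :=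
  ∀ j < k, ¬ t.StopsAt j

/-- `t` records a run of SD-DROP for the objective `f` and the set `X`, started at an arbitrary element
of `X`, with arbitrary admissible oracle answers. The entries of `t` after the iteration in which the
run stops are unconstrained. -/
structure IsRun {n : ℕ} (f : (Fin n → ℝ) → ℝ) (X : Set (Fin n → ℝ)) (t : SDTrace n) : Prop where
  init : ∃ x₀ ∈ X, t.V 0 = {x₀}
  sim : ∀ k, t.Reaches k → IsSimOutput f (t.V k) (t.α k) (t.x k) (t.c k)
  lin : ∀ k, t.Reaches k → IsLinOutput X (t.c k) (t.xhat k)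
  update : ∀ k, t.Reaches k → ¬ t.StopsAt k → t.V (k + 1) = dropUpdate (t.V k) (t.α k) (t.xhat k)

/-- The run terminates after finitely many iterations. -/
def Terminates {n : ℕ} (t : SDTrace n) : Prop :=
  ∃ k, t.Reaches k ∧ t.StopsAt k

end SDTrace

/-! The value of an iterate is determined by `V`, and `X` has finitely many subsets, so a run
terminates once every non-stopping iteration strictly decreases the objective. Suppose adding `y` to
the support `S` of `α` brings no decrease. Then `x` stays optimal: besides the old subgradient,
negative on `y - x`, there is one at `x` that is nonnegative there, and both are constant on `S`.
Some convex combination `g` of them is constant on `S ∪ {y}` (`GeneralPosition.worstCase_lt`).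
Generic scenarios exclude such a `g` by counting (`GeneralPosition.not_constant_on`). Let `g` be a
combination of `s` active gradients and `r = dim aff S + 1`. If `s ≤ r`, these gradients are
dependent on directions in which `g` vanishes; if `s > r`, more than `r` scenarios tie at a point of
`aff S`. Either way a square matrix linear in the scenarios is singular, which has probability zero.
-/

/-! ### Generic invertibility in linear families of matrices -/

/-- If a linear family of square matrices contains the identity, then almost every member of the
family is invertible. -/
theorem ae_det_ne_zero {E : Type*} [NormedAddCommGroup E] [NormedSpace ℝ E]
    [FiniteDimensional ℝ E] [MeasurableSpace E] [BorelSpace E] (μ : Measure E)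
    [μ.IsAddHaarMeasure] {ι : Type*} [Fintype ι] [DecidableEq ι]
    (Φ : E →ₗ[ℝ] Matrix ι ι ℝ) {e : E} (he : Φ e = 1) : ∀ᵐ y ∂μ, (Φ y).det ≠ 0 := by
  have hcont : Continuous fun y => (Φ y).det :=
    (LinearMap.continuous_of_finiteDimensional Φ).matrix_det
  -- Fubini along the lines parallel to `e`: on each, the determinant is the characteristic
  -- polynomial of `-Φ y` evaluated at `t`, so it has finitely many zeros.
  refine ae_mem_of_ae_add_linearMap_mem (LinearMap.toSpanSingleton ℝ E e) volume μ
    (s := {y | (Φ y).det ≠ 0}) (isOpen_ne_fun hcont continuous_const).measurableSet fun y => ?_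
  have hfin : {t : ℝ | (-(Φ y)).charpoly.IsRoot t}.Finite :=
    Polynomial.finite_setOfPred_isRoot (Matrix.charpoly_monic _).ne_zero
  filter_upwards [hfin.countable.ae_notMem volume] with t ht h0
  refine ht ?_
  have h1 : Φ (y + t • e) = Matrix.scalar ι t - -(Φ y) := by
    rw [map_add, map_smul, he, sub_neg_eq_add, add_comm]
    simp [Matrix.smul_one_eq_diagonal]
  change Polynomial.eval t _ = 0
  rw [Matrix.eval_charpoly, ← h1]
  simpa using h0

/-- A finite linearly independent family has a dual family of linear functionals. -/
theorem LinearIndependent.exists_dual_family {E ι : Type*} [AddCommGroup E] [Module ℝ E]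
    [Fintype ι] [DecidableEq ι] {w : ι → E} (hw : LinearIndependent ℝ w) :
    ∃ φ : ι → E →ₗ[ℝ] ℝ, ∀ i l, φ i (w l) = (1 : Matrix ι ι ℝ) i l := by
  obtain ⟨g, hg⟩ := LinearMap.exists_leftInverse_of_injective (Fintype.linearCombination ℝ w)
    (LinearMap.ker_eq_bot.2 (linearIndependent_iff_injective_fintypeLinearCombination.1 hw))
  refine ⟨fun i => LinearMap.proj i ∘ₗ g, fun i l => ?_⟩
  have h := LinearMap.congr_fun hg (Pi.single l 1)
  simp only [LinearMap.comp_apply, Fintype.linearCombination_apply_single, one_smul,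
    LinearMap.id_apply] at h
  simp [h, Matrix.one_apply, Pi.single_apply]

theorem LinearMap.exists_eq_dotProduct {n : ℕ} (φ : (Fin n → ℝ) →ₗ[ℝ] ℝ) :
    ∃ a : Fin n → ℝ, ∀ x, φ x = a ⬝ᵥ x :=
  ⟨fun i => φ (Pi.single i 1), fun x => by
    conv_lhs => rw [← Finset.univ_sum_single x]
    simp only [map_sum, dotProduct]
    refine Finset.sum_congr rfl fun i _ => ?_
    rw [mul_comm, ← smul_eq_mul, ← map_smul, ← Pi.single_smul, smul_eq_mul, mul_one]⟩

/-! ### Scenarios in general position -/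

/-- The affine function `x ↦ c̄ᵀ x + c̃` of the scenario `(c̃, c̄)`. -/
def scenarioCost {n : ℕ} (c : ℝ × (Fin n → ℝ)) (x : Fin n → ℝ) : ℝ :=
  c.2 ⬝ᵥ x + c.1

/-- Scenarios in general position with respect to `X`. -/
structure GeneralPosition {n m : ℕ} (X : Set (Fin n → ℝ)) (C : Fin m → ℝ × (Fin n → ℝ)) :
    Prop where
  -- Excludes a subgradient with few active scenarios that is constant on `S ∪ {q}`.
  directions : ∀ (k : ℕ) (j : Fin k → Fin m) (q : X) (p : Fin k → X), Function.Injective j →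
    LinearIndependent ℝ (fun l => (q - p l : Fin n → ℝ)) →
    (Matrix.of fun i l => (C (j i)).2 ⬝ᵥ (q - p l : Fin n → ℝ)).det ≠ 0
  -- Excludes `k + 1` scenarios with a common value at an affine combination of the `p l`.
  values : ∀ (k : ℕ) (j : Fin (k + 1) → Fin m) (p : Fin k → X), Function.Injective j →
    LinearIndependent ℝ (fun l => ((1 : ℝ), (p l : Fin n → ℝ))) →
    (Matrix.of fun (i : Fin k) (l : Fin k) =>
      scenarioCost (C (j i.succ)) (p l) - scenarioCost (C (j 0)) (p l)).det ≠ 0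

theorem isAddHaarMeasure_volume_scenarios (n m : ℕ) :
    (volume : Measure (Fin m → ℝ × (Fin n → ℝ))).IsAddHaarMeasure :=
  have : (volume : Measure (ℝ × (Fin n → ℝ))).IsAddHaarMeasure :=
    Measure.prod.instIsAddHaarMeasure _ _
  Measure.pi.isAddHaarMeasure _

/-- Taking a dual family of `u` as the gradients turns the matrix into the identity. -/
theorem ae_det_directions_ne_zero {n m k : ℕ} {j : Fin k → Fin m} (hj : Function.Injective j)
    {u : Fin k → Fin n → ℝ} (hu : LinearIndependent ℝ u) :
    ∀ᵐ C : Fin m → ℝ × (Fin n → ℝ), (Matrix.of fun i l => (C (j i)).2 ⬝ᵥ u l).det ≠ 0 := by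
  have := isAddHaarMeasure_volume_scenarios n m
  obtain ⟨φ, hφ⟩ := hu.exists_dual_family
  choose a ha using fun i => (φ i).exists_eq_dotProduct
  let Φ : (Fin m → ℝ × (Fin n → ℝ)) →ₗ[ℝ] Matrix (Fin k) (Fin k) ℝ :=
    { toFun := fun C => Matrix.of fun i l => (C (j i)).2 ⬝ᵥ u l
      map_add' := fun C D => by ext i l; simp [add_dotProduct]
      map_smul' := fun r C => by ext i l; simp }
  have he : Φ (Function.extend j (fun i => (0, a i)) 0) = 1 := by
    ext i l
    simp [Φ, hj.extend_apply, ← ha, hφ]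
  exact ae_det_ne_zero volume Φ he

/-- Functionals dual to the lifted points `(1, p l)` are affine functions of `p l`. Using them as
scenarios `j 1, …, j k`, with scenario `j 0` zero, gives the identity matrix. -/
theorem ae_det_values_ne_zero {n m k : ℕ} {j : Fin (k + 1) → Fin m} (hj : Function.Injective j)
    {p : Fin k → Fin n → ℝ} (hp : LinearIndependent ℝ (fun l => ((1 : ℝ), p l))) :
    ∀ᵐ C : Fin m → ℝ × (Fin n → ℝ), (Matrix.of fun (i : Fin k) (l : Fin k) =>
      scenarioCost (C (j i.succ)) (p l) - scenarioCost (C (j 0)) (p l)).det ≠ 0 := by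
  have := isAddHaarMeasure_volume_scenarios n m
  obtain ⟨φ, hφ⟩ := hp.exists_dual_family
  choose a ha using fun i => (φ i ∘ₗ LinearMap.inr ℝ ℝ (Fin n → ℝ)).exists_eq_dotProduct
  have hval : ∀ i x, a i ⬝ᵥ x + φ i (1, 0) = φ i (1, x) := fun i x => by
    rw [← ha, LinearMap.comp_apply, ← map_add]
    simp
  have hj' : Function.Injective (fun i : Fin k => j i.succ) :=
    hj.comp (Fin.succ_injective k)
  let Φ : (Fin m → ℝ × (Fin n → ℝ)) →ₗ[ℝ] Matrix (Fin k) (Fin k) ℝ :=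
    { toFun := fun C => Matrix.of fun (i : Fin k) (l : Fin k) =>
        scenarioCost (C (j i.succ)) (p l) - scenarioCost (C (j 0)) (p l)
      map_add' := fun C D => by ext i l; simp [scenarioCost, add_dotProduct]; ring
      map_smul' := fun r C => by ext i l; simp [scenarioCost]; ring }
  have he : Φ (Function.extend (fun i : Fin k => j i.succ) (fun i => (φ i (1, 0), a i)) 0)
      = 1 := by
    ext i l
    have h0 : Function.extend (fun i : Fin k => j i.succ) (fun i => (φ i (1, 0), a i)) 0 (j 0)
        = 0 := Function.extend_apply' _ _ _ fun ⟨i, hi⟩ => Fin.succ_ne_zero i (hj hi)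
    simp [Φ, scenarioCost, h0, hj'.extend_apply (fun i => (φ i (1, 0), a i)), hval, hφ]
  exact ae_det_ne_zero volume Φ he

theorem ae_generalPosition {n m : ℕ} {X : Set (Fin n → ℝ)} (hX : X.Finite) :
    ∀ᵐ C : Fin m → ℝ × (Fin n → ℝ), GeneralPosition X C := by
  have := hX.to_subtype
  have h1 := ae_all_iff.2 fun k => ae_all_iff.2 fun j : Fin k → Fin m =>
    ae_all_iff.2 fun q : X => ae_all_iff.2 fun p : Fin k → X =>
    ae_all_iff.2 fun hj : Function.Injective j =>
    ae_all_iff.2 fun hu : LinearIndependent ℝ (fun l => (q - p l : Fin n → ℝ)) =>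
      ae_det_directions_ne_zero hj hu
  have h2 := ae_all_iff.2 fun k => ae_all_iff.2 fun j : Fin (k + 1) → Fin m =>
    ae_all_iff.2 fun p : Fin k → X => ae_all_iff.2 fun hj : Function.Injective j =>
    ae_all_iff.2 fun hp : LinearIndependent ℝ (fun l => ((1 : ℝ), (p l : Fin n → ℝ))) =>
      ae_det_values_ne_zero hj hp
  filter_upwards [h1, h2] with C hC1 hC2 using ⟨hC1, hC2⟩

/-! ### Subgradients of a maximum of affine functions -/

theorem exists_scenarioCost_eq_worstCase {n m : ℕ} [NeZero m] (C : Fin m → ℝ × (Fin n → ℝ))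
    (x : Fin n → ℝ) : ∃ j, scenarioCost (C j) x = worstCase C x := by
  obtain ⟨j, -, hj⟩ := Finset.exists_mem_eq_sup' Finset.univ_nonempty
    (fun j : Fin m => (C j).2 ⬝ᵥ x + (C j).1)
  exact ⟨j, hj.symm⟩

theorem continuous_scenarioCost {n : ℕ} (c : ℝ × (Fin n → ℝ)) : Continuous (scenarioCost c) := by
  unfold scenarioCost dotProduct
  fun_prop

theorem continuous_worstCase {n m : ℕ} [NeZero m] (C : Fin m → ℝ × (Fin n → ℝ)) :
    Continuous (worstCase C) :=
  Continuous.finset_sup'_apply Finset.univ_nonempty fun j _ => continuous_scenarioCost (C j)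

/-- In every direction `d`, some scenario active at `x` is at least as steep as a given
subgradient. -/
theorem exists_active_dotProduct_le {n m : ℕ} [NeZero m] {C : Fin m → ℝ × (Fin n → ℝ)}
    {x g : Fin n → ℝ} (hg : g ∈ subdiff (worstCase C) x) (d : Fin n → ℝ) :
    ∃ j, scenarioCost (C j) x = worstCase C x ∧ g ⬝ᵥ d ≤ (C j).2 ⬝ᵥ d := by
  let u : ℕ → ℝ := fun i => 1 / ((i : ℝ) + 1)
  have hu : Filter.Tendsto (fun i => x + u i • d) Filter.atTop (nhds x) := by
    simpa [u] using (tendsto_const_nhds (x := x)).add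
      ((tendsto_one_div_add_atTop_nhds_zero_nat (𝕜 := ℝ)).smul_const d)
  choose J hJ using fun i : ℕ => exists_scenarioCost_eq_worstCase C (x + u i • d)
  -- By pigeonhole one scenario attains the maximum at infinitely many points approaching `x` along
  -- `d`; by continuity it is active at `x`.
  obtain ⟨j, hj⟩ : ∃ j, ∃ᶠ i in Filter.atTop, J i = j := by
    simpa using (Filter.frequently_exists_finite (l := Filter.atTop) (p := fun j i => J i = j)
      Set.finite_univ).1 (Filter.Frequently.of_forall fun i => ⟨J i, trivial, rfl⟩)
  have hlim : scenarioCost (C j) x = worstCase C x := by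
    have h1 : Filter.Tendsto (fun i => scenarioCost (C j) (x + u i • d) - worstCase C (x + u i • d))
        Filter.atTop (nhds (scenarioCost (C j) x - worstCase C x)) :=
      (((continuous_scenarioCost (C j)).tendsto x).comp hu).sub
        (((continuous_worstCase C).tendsto x).comp hu)
    refine sub_eq_zero.1 (isClosed_singleton.mem_of_frequently_of_tendsto (s := {(0 : ℝ)})
      (hj.mono fun i hi => ?_) h1)
    simp [← hi, hJ i]
  obtain ⟨i, hi⟩ := hj.exists
  refine ⟨j, hlim, ?_⟩
  have hpos : 0 < u i := by positivity
  have h1 := hg (x + u i • d)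
  rw [← hJ i, hi, ← hlim, add_sub_cancel_left] at h1
  simp only [scenarioCost, dotProduct_add, dotProduct_smul, smul_eq_mul] at h1
  nlinarith

/-- Subgradients of a maximum of affine functions are convex combinations of the gradients of the
active ones. -/
theorem exists_weights_of_mem_subdiff {n m : ℕ} [NeZero m] {C : Fin m → ℝ × (Fin n → ℝ)}
    {x g : Fin n → ℝ} (hg : g ∈ subdiff (worstCase C) x) :
    ∃ w : Fin m → ℝ, ∑ j, w j = 1 ∧ (∀ j, w j ≠ 0 → scenarioCost (C j) x = worstCase C x) ∧
      g = ∑ j, w j • (C j).2 := by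
  let S : Set (Fin m → ℝ) :=
    stdSimplex ℝ (Fin m) ∩ {w | ∀ j, scenarioCost (C j) x ≠ worstCase C x → w j = 0}
  let Φ : (Fin m → ℝ) →ₗ[ℝ] (Fin n → ℝ) := Fintype.linearCombination ℝ fun j => (C j).2
  have hclosed : IsClosed {w : Fin m → ℝ | ∀ j, scenarioCost (C j) x ≠ worstCase C x → w j = 0} := by
    simp only [Set.ofPred_forall]
    exact isClosed_iInter fun j => isClosed_iInter fun _ =>
      isClosed_eq (continuous_apply j) continuous_const
  have hconv : Convex ℝ {w : Fin m → ℝ | ∀ j, scenarioCost (C j) x ≠ worstCase C x → w j = 0} := by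
    intro v hv w hw a b _ _ _ j hj
    simp [hv j hj, hw j hj]
  have hcomp : IsCompact (Φ '' S) := ((isCompact_stdSimplex ℝ (Fin m)).inter_right hclosed).image
    (LinearMap.continuous_of_finiteDimensional Φ)
  by_cases hmem : g ∈ Φ '' S
  · obtain ⟨w, ⟨hw, hw0⟩, rfl⟩ := hmem
    exact ⟨w, hw.2, fun j hj => by_contra fun h => hj (hw0 j h), rfl⟩
  -- `Φ '' S` is the convex hull of the active gradients. A functional separating `g` from it would
  -- be a direction in which `g` is steeper than every active scenario.
  obtain ⟨φ, u, h1, h2⟩ := geometric_hahn_banach_closed_point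
    (((convex_stdSimplex ℝ (Fin m)).inter hconv).linear_image Φ) hcomp.isClosed hmem
  obtain ⟨d, hd⟩ := (φ : (Fin n → ℝ) →ₗ[ℝ] ℝ).exists_eq_dotProduct
  obtain ⟨j, hj, hle⟩ := exists_active_dotProduct_le hg d
  have h3 := h1 _ ⟨Pi.single j 1, ⟨single_mem_stdSimplex ℝ j, fun i hi => by
    rw [Pi.single_eq_of_ne]; rintro rfl; exact hi hj⟩, rfl⟩
  have h4 : Φ (Pi.single j 1) = (C j).2 := by simp [Φ]
  have hd' : ∀ y, φ y = y ⬝ᵥ d := fun y => (hd y).trans (dotProduct_comm _ _)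
  rw [h4, hd'] at h3
  rw [hd'] at h2
  linarith

/-! ### The counting argument -/

theorem sum_mul_scenarioCost {n : ℕ} {ι : Type*} (s : Finset ι) {β : ι → ℝ}
    (hβ : ∑ l ∈ s, β l = 1) (p : ι → Fin n → ℝ) (c : ℝ × (Fin n → ℝ)) :
    ∑ l ∈ s, β l * scenarioCost c (p l) = scenarioCost c (∑ l ∈ s, β l • p l) := by
  simp only [scenarioCost, mul_add, Finset.sum_add_distrib, ← Finset.sum_mul, hβ, one_mul,
    dotProduct_sum, dotProduct_smul, smul_eq_mul]

/-- In general position, no subgradient at a point `x` of the affine hull of `S ⊆ X` is constant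
on `S ∪ {y}` if some `c` separates `y ∈ X` from this affine hull. -/
theorem GeneralPosition.not_constant_on {n m : ℕ} [NeZero m] {X : Set (Fin n → ℝ)}
    {C : Fin m → ℝ × (Fin n → ℝ)} (hC : GeneralPosition X C) {S : Finset (Fin n → ℝ)}
    (hS : ↑S ⊆ X) {α : (Fin n → ℝ) → ℝ} {x y g c : Fin n → ℝ} (hy : y ∈ X)
    (hα : ∑ v ∈ S, α v = 1) (hx : x = ∑ v ∈ S, α v • v)
    (hc : ∀ v ∈ S, c ⬝ᵥ (v - x) = 0) (hcy : c ⬝ᵥ (y - x) ≠ 0)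
    (hg : g ∈ subdiff (worstCase C) x) (hgS : ∀ v ∈ S, g ⬝ᵥ (v - x) = 0)
    (hgy : g ⬝ᵥ (y - x) = 0) : False := by
  obtain ⟨w, hw1, hwact, hgw⟩ := exists_weights_of_mem_subdiff hg
  -- The points `p l` form an affine basis of the affine hull of `S`, chosen inside `S`.
  obtain ⟨f, hf, hspan, hli⟩ := Submodule.exists_fun_fin_finrank_span_eq ℝ
    ((fun v : Fin n → ℝ => ((1 : ℝ), v)) '' (S : Set (Fin n → ℝ)))
  generalize Module.finrank ℝ (Submodule.span ℝ
    ((fun v : Fin n → ℝ => ((1 : ℝ), v)) '' (S : Set (Fin n → ℝ)))) = r at f hf hspan hli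
  choose p hpS hpf using hf
  obtain rfl : f = fun l => ((1 : ℝ), p l) := funext fun l => (hpf l).symm
  have hsum (l) : y - p l = (y - x) - (p l - x) := by abel
  have hdir : LinearIndependent ℝ (fun l => y - p l) := by
    rw [Fintype.linearIndependent_iff] at hli ⊢
    intro γ hγ
    -- Applying `c`, which vanishes on each `p l - x`, leaves only the multiples of `y - x`.
    have h1 : (∑ l, γ l) * (c ⬝ᵥ (y - x)) = 0 := by
      have h2 := congrArg (c ⬝ᵥ ·) hγ
      simp only [dotProduct_sum, dotProduct_smul, smul_eq_mul, dotProduct_zero, hsum,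
        dotProduct_sub c (y - x), hc _ (hpS _), sub_zero] at h2
      rw [Finset.sum_mul, h2]
    have h3 : ∑ l, γ l = 0 := (mul_eq_zero.1 h1).resolve_right hcy
    refine hli γ ?_
    simp only [smul_sub, Finset.sum_sub_distrib, ← Finset.sum_smul, h3, zero_smul, zero_sub,
      neg_eq_zero] at hγ
    ext1
    · simpa [Prod.fst_sum] using h3
    · simpa [Prod.snd_sum] using hγ
  let J : Finset (Fin m) := Finset.univ.filter fun j => w j ≠ 0
  let e := J.orderEmbOfFin rfl
  have hJ (i) : w (e i) ≠ 0 := (Finset.mem_filter.1 (J.orderEmbOfFin_mem rfl i)).2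
  rcases le_or_gt J.card r with hle | hlt
  · refine hC.directions J.card e ⟨y, hy⟩ (fun i => ⟨p (Fin.castLE hle i), hS (hpS _)⟩) e.injective
      (hdir.comp _ (Fin.castLE_injective hle)) (Matrix.exists_vecMul_eq_zero_iff.1 ?_)
    have hne : J.Nonempty := by
      by_contra h
      rw [Finset.not_nonempty_iff_eq_empty, Finset.filter_eq_empty_iff] at h
      exact zero_ne_one (hw1 ▸ (Finset.sum_eq_zero fun j hj => not_not.1 (h hj)).symm)
    refine ⟨fun i => w (e i), fun h => hJ ⟨0, hne.card_pos⟩ (congrFun h _), funext fun l => ?_⟩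
    have hsumJ (F : Fin m → ℝ) : ∑ i, w (e i) * F (e i) = ∑ j, w j * F j := by
      rw [← Finset.sum_filter_of_ne (p := fun j => w j ≠ 0)
        fun j _ h hj => h (by rw [hj, zero_mul])]
      exact (Finset.sum_map Finset.univ e.toEmbedding fun j => w j * F j).symm.trans
        (congrArg (fun T : Finset (Fin m) => ∑ j ∈ T, w j * F j) (J.map_orderEmbOfFin_univ rfl))
    change ∑ i, w (e i) * ((C (e i)).2 ⬝ᵥ (y - p (Fin.castLE hle l))) = 0
    rw [hsumJ fun j => (C j).2 ⬝ᵥ (y - p (Fin.castLE hle l))]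
    have : g ⬝ᵥ (y - p (Fin.castLE hle l)) = 0 := by
      rw [hsum, dotProduct_sub, hgy, hgS _ (hpS _), sub_zero]
    rw [hgw, sum_dotProduct] at this
    simpa only [smul_dotProduct, smul_eq_mul] using this
  -- Many scenarios: the affine coordinates `β` of `x` form a right kernel vector, because `r + 1`
  -- scenarios of `J` agree at `x`; `β ≠ 0` since it sums to one.
  · have hmem : ((1 : ℝ), x) ∈ Submodule.span ℝ (Set.range fun l => ((1 : ℝ), p l)) := by
      rw [hspan]
      have : ((1 : ℝ), x) = ∑ v ∈ S, α v • ((1 : ℝ), v) := by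
        ext1
        · simp [Prod.fst_sum, hα]
        · simp [Prod.snd_sum, hx]
      rw [this]
      exact Submodule.sum_mem _ fun v hv =>
        Submodule.smul_mem _ _ (Submodule.subset_span ⟨v, hv, rfl⟩)
    obtain ⟨β, hβ⟩ := (Submodule.mem_span_range_iff_exists_fun ℝ).1 hmem
    have hβ1 : ∑ l, β l = 1 := by simpa [Prod.fst_sum] using congrArg Prod.fst hβ
    have hβx : ∑ l, β l • p l = x := by simpa [Prod.snd_sum] using congrArg Prod.snd hβ
    refine hC.values r (fun i => e (Fin.castLE hlt i)) (fun l => ⟨p l, hS (hpS l)⟩)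
      (e.injective.comp (Fin.castLE_injective hlt)) hli (Matrix.exists_mulVec_eq_zero_iff.1
        ⟨β, fun h => by simp [h] at hβ1, funext fun i => ?_⟩)
    change ∑ l, (scenarioCost (C (e (Fin.castLE hlt i.succ))) (p l)
      - scenarioCost (C (e (Fin.castLE hlt 0))) (p l)) * β l = 0
    simp only [mul_comm _ (β _), mul_sub, Finset.sum_sub_distrib,
      sum_mul_scenarioCost Finset.univ hβ1, hβx, hwact _ (hJ _), sub_self]

/-! ### Strict descent and termination -/

namespace IsSimOutput

variable {n : ℕ} {f : (Fin n → ℝ) → ℝ} {V : Finset (Fin n → ℝ)} {α : (Fin n → ℝ) → ℝ}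
  {x c : Fin n → ℝ}

theorem dotProduct_nonneg (h : IsSimOutput f V α x c) {y : Fin n → ℝ}
    (hy : y ∈ convexHull ℝ (V : Set (Fin n → ℝ))) : 0 ≤ c ⬝ᵥ (y - x) := by
  simpa using h.neg_mem_normalCone.2 y hy

theorem le_of_mem_convexHull (h : IsSimOutput f V α x c) {y : Fin n → ℝ}
    (hy : y ∈ convexHull ℝ (V : Set (Fin n → ℝ))) : f x ≤ f y := by
  linarith [h.mem_subdiff y, h.dotProduct_nonneg hy]

theorem value_unique (h : IsSimOutput f V α x c) {α' : (Fin n → ℝ) → ℝ} {x' c' : Fin n → ℝ}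
    (h' : IsSimOutput f V α' x' c') : f x = f x' :=
  le_antisymm (h.le_of_mem_convexHull h'.neg_mem_normalCone.1)
    (h'.le_of_mem_convexHull h.neg_mem_normalCone.1)

end IsSimOutput

/-- With all coefficients positive, the nonnegative terms average to zero, so each vanishes. This is
where dropping the points of zero weight matters. -/
theorem dotProduct_eq_zero_of_convex_combination {n : ℕ} {S : Finset (Fin n → ℝ)}
    {α : (Fin n → ℝ) → ℝ} {x g : Fin n → ℝ} (hpos : ∀ v ∈ S, 0 < α v)
    (hα : ∑ v ∈ S, α v = 1) (hx : x = ∑ v ∈ S, α v • v)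
    (hg : ∀ v ∈ S, 0 ≤ g ⬝ᵥ (v - x)) : ∀ v ∈ S, g ⬝ᵥ (v - x) = 0 := by
  have h0 : ∑ v ∈ S, α v * (g ⬝ᵥ (v - x)) = 0 := by
    have : ∑ v ∈ S, α v • (v - x) = 0 := by
      simp only [smul_sub, Finset.sum_sub_distrib, ← Finset.sum_smul, hα, one_smul, ← hx, sub_self]
    simpa [dotProduct_sum, dotProduct_smul] using congrArg (g ⬝ᵥ ·) this
  intro v hv
  have := (Finset.sum_eq_zero_iff_of_nonneg fun v hv => mul_nonneg (hpos v hv).le (hg v hv)).1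
    h0 v hv
  exact (mul_eq_zero.1 this).resolve_left (hpos v hv).ne'

theorem convex_subdiff {n : ℕ} (f : (Fin n → ℝ) → ℝ) (x : Fin n → ℝ) :
    Convex ℝ (subdiff f x) := by
  intro g hg g' hg' a b ha hb hab y
  have h1 := mul_le_mul_of_nonneg_left (hg y) ha
  have h2 := mul_le_mul_of_nonneg_left (hg' y) hb
  have h3 : b = 1 - a := by linarith
  simp only [add_dotProduct, smul_dotProduct, smul_eq_mul]
  subst h3
  linarith

/-- In general position, every iteration that does not stop decreases the objective value. -/
theorem GeneralPosition.worstCase_lt {n m : ℕ} [NeZero m] {X : Set (Fin n → ℝ)}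
    {C : Fin m → ℝ × (Fin n → ℝ)} (hC : GeneralPosition X C) {V : Finset (Fin n → ℝ)}
    (hV : ↑V ⊆ X) {α α' : (Fin n → ℝ) → ℝ} {x c y x' c' : Fin n → ℝ}
    (h : IsSimOutput (worstCase C) V α x c) (hy : y ∈ X) (hlt : c ⬝ᵥ y < c ⬝ᵥ x)
    (h' : IsSimOutput (worstCase C) (dropUpdate V α y) α' x' c') :
    worstCase C x' < worstCase C x := by
  classical
  set S := V.filter fun v => 0 < α v with hSdef
  have hSV : S ⊆ V := Finset.filter_subset _ _
  have hzero : ∀ v ∈ V, v ∉ S → α v = 0 := fun v hv hvS =>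
    le_antisymm (not_lt.1 fun hp => hvS (Finset.mem_filter.2 ⟨hv, hp⟩)) (h.nonneg v hv)
  have hpos : ∀ v ∈ S, 0 < α v := fun v hv => (Finset.mem_filter.1 hv).2
  have hα : ∑ v ∈ S, α v = 1 := (Finset.sum_subset hSV hzero).trans h.sum_eq_one
  have hx : x = ∑ v ∈ S, α v • v := h.point_eq.trans
    (Finset.sum_subset hSV fun v hv hvS => by rw [hzero v hv hvS, zero_smul]).symm
  have hSnew : ∀ v ∈ S, v ∈ convexHull ℝ (dropUpdate V α y : Set (Fin n → ℝ)) := fun v hv =>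
    subset_convexHull ℝ _ (by simpa [dropUpdate] using Or.inr (Finset.mem_filter.1 hv))
  have hynew : y ∈ convexHull ℝ (dropUpdate V α y : Set (Fin n → ℝ)) :=
    subset_convexHull ℝ _ (by simp [dropUpdate])
  have hxnew : x ∈ convexHull ℝ (dropUpdate V α y : Set (Fin n → ℝ)) := hx ▸
    (convex_convexHull ℝ _).sum_mem (fun v hv => (hpos v hv).le) hα hSnew
  by_contra hge
  -- Without descent `x` is optimal on the new hull too, which makes `c'` a subgradient at `x` as
  -- well.
  have hc'x : c' ⬝ᵥ (x - x') = 0 :=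
    le_antisymm (by linarith [h'.mem_subdiff x]) (h'.dotProduct_nonneg hxnew)
  have hshift (z) : c' ⬝ᵥ (z - x') = c' ⬝ᵥ (z - x) := by
    rw [← sub_add_sub_cancel z x x', dotProduct_add, hc'x, add_zero]
  have hsub' : c' ∈ subdiff (worstCase C) x := fun z => by
    linarith [h'.mem_subdiff z, h'.le_of_mem_convexHull hxnew, hshift z]
  have hcS := dotProduct_eq_zero_of_convex_combination hpos hα hx fun v hv =>
    h.dotProduct_nonneg (subset_convexHull ℝ _ (hSV hv))
  have hc'S := dotProduct_eq_zero_of_convex_combination hpos hα hx fun v hv =>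
    (hshift v).symm ▸ h'.dotProduct_nonneg (hSnew v hv)
  have hcy : c ⬝ᵥ (y - x) < 0 := by rw [dotProduct_sub]; linarith
  have hc'y : 0 ≤ c' ⬝ᵥ (y - x) := hshift y ▸ h'.dotProduct_nonneg hynew
  set A := c ⬝ᵥ (y - x) with hA
  set B := c' ⬝ᵥ (y - x) with hB
  have hBA : 0 < B - A := by linarith
  -- As `A < 0 ≤ B`, these weights are convex coefficients, and they cancel the values `A` and `B`
  -- on `y - x`.
  have hg := convex_subdiff _ x h.mem_subdiff hsub' (a := B / (B - A)) (b := -A / (B - A))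
    (by positivity) (div_nonneg (by linarith) hBA.le) (by field_simp; ring)
  refine hC.not_constant_on (fun v hv => hV (hSV hv)) hy hα hx hcS hcy.ne hg (fun v hv => ?_) ?_
  · simp only [add_dotProduct, smul_dotProduct, hcS v hv, hc'S v hv, smul_zero, add_zero]
  · simp only [add_dotProduct, smul_dotProduct, smul_eq_mul, ← hA, ← hB]
    field_simp
    ring

theorem GeneralPosition.terminates {n m : ℕ} [NeZero m] {X : Set (Fin n → ℝ)} (hX : X.Finite)
    {C : Fin m → ℝ × (Fin n → ℝ)} (hC : GeneralPosition X C) {t : SDTrace n}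
    (ht : t.IsRun (worstCase C) X) : t.Terminates := by
  by_contra hterm
  have hrun : ∀ k, t.Reaches k → ¬ t.StopsAt k := fun k hk hs => hterm ⟨k, hk, hs⟩
  have hreach : ∀ k, t.Reaches k := fun k => by
    induction k using Nat.strong_induction_on with
    | _ k ih => exact fun j hj => hrun j (ih j hj)
  have hupd (k) := ht.update k (hreach k) (hrun k (hreach k))
  have hVX : ∀ k, (t.V k : Set (Fin n → ℝ)) ⊆ X := fun k => by
    induction k with
    | zero =>
      obtain ⟨x₀, hx₀, h0⟩ := ht.init
      simpa [h0] using hx₀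
    | succ k ih =>
      intro v hv
      rw [hupd k] at hv
      simp only [dropUpdate, Finset.coe_union, Finset.coe_filter, Finset.coe_singleton] at hv
      rcases hv with hv | rfl
      · exact ih hv.1
      · exact (ht.lin k (hreach k)).1
  have hanti : StrictAnti fun k => worstCase C (t.x k) := strictAnti_nat_of_succ_lt fun k =>
    hC.worstCase_lt (hVX k) (ht.sim k (hreach k)) (ht.lin k (hreach k)).1
      (not_le.1 (hrun k (hreach k))) (hupd k ▸ ht.sim (k + 1) (hreach (k + 1)))
  -- An infinite run would repeat some `V`, hence its optimal value, against strict descent.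
  obtain ⟨i, -, j, -, hij, hVij⟩ := Set.infinite_univ.exists_ne_map_eq_of_mapsTo
    (f := t.V) (t := (hX.toFinset.powerset : Set (Finset (Fin n → ℝ))))
    (fun k _ => by simpa [Set.subset_def, Finset.subset_iff] using hVX k) (Finset.finite_toSet _)
  exact hij (hanti.injective
    ((ht.sim i (hreach i)).value_unique (hVij ▸ ht.sim j (hreach j))))

theorem mainTheorem3 {n m : ℕ} [NeZero m]
    (X : Set (Fin n → ℝ)) (hX : X.Finite)
    (c : Fin m → ℝ × (Fin n → ℝ))
    {Ω : Type*} [MeasurableSpace Ω] (P : Measure Ω) [IsProbabilityMeasure P]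
    (δ : Ω → (Fin m → ℝ × (Fin n → ℝ))) (hδ : HasPDF δ P volume) :
    ∀ᵐ ω ∂P, ∀ t : SDTrace n, t.IsRun (worstCase (c + δ ω)) X → t.Terminates := by
  have := isAddHaarMeasure_volume_scenarios n m
  -- General position concerns the scenarios alone, so one null set serves all runs; translation by
  -- `c` preserves null sets.
  have h1 : ∀ᵐ C : Fin m → ℝ × (Fin n → ℝ), GeneralPosition X (c + C) :=
    (measurePreserving_add_left volume c).quasiMeasurePreserving.ae (ae_generalPosition hX)
  have h2 : ∀ᵐ C ∂(P.map δ), GeneralPosition X (c + C) := hδ.absolutelyContinuous'.ae_le h1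
  filter_upwards [ae_of_ae_map hδ.aemeasurable' h2] with ω hω t ht using hω.terminates hX ht
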